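/- Let $(M,g)$ be a compact connected smooth Riemannian manifold with boundary, let $B$ be a smooth manifold without boundary with $\dim M=\dim B+1$, and let $(M,\mathcal F,\mathrm{pr})$ be a foliated $I$-bundle, $I=[0,1]$: that is, $\mathrm{pr}:M\to B$ is a smooth fibre bundle with fibre $I$, and $\mathcal F$ is a smooth codimension-one foliation of $M$, tangent to $\partial M$ and transverse to the fibres (for every $x\in M$, $T_xM$ is the direct sum of $T_x\mathcal F$ and the tangent space of the fibre through $x$). For leaves $L,L'$ let $\mathrm{dist}(L,L')$ be the infimum of the Riemannian distances in $M$ between points of $L$ and points of $L'$, and let $$\rho(L,L')=\inf\sum_{i=1}^{n-1}\mathrm{dist}(L_i,L_{i+1}),$$ the infimum being over all finite sequences of leaves $L_1=L,\dots,L_n=L'$. The Hausdorff leaf space $\mathrm{HLS}(\mathcal F)$ is the quotient of the set of leaves by the relation $\rho(L,L')=0$, with the metric $\tilde\rho([L],[L'])=\rho(L,L')$. Then $\mathcal F$ has a leaf contained in $\partial M$. For every such boundary leaf $L_0$ the maximum $\delta=\max_{L}\tilde\rho([L_0],[L])$ over all leaves $L$ of $\mathcal F$ exists, and $\mathrm{HLS}(\mathcal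 F)$ is isometric to the metric segment $[0,\delta]$ with the metric $|s-t|$ (a single point if $\delta=0$). -/

import Mathlib

open Set Filter Topology Manifold Bundle
open scoped ContDiff

/-- The local model `ℝᵐ × [0, ∞)` of an `(m+1)`-dimensional manifold with boundary, written as a
product of a leaf coordinate in `ℝᵐ` and a transverse coordinate in the half-line. -/
abbrev HalfBox (m : ℕ) : Type :=
  ModelProd (EuclideanSpace ℝ (Fin m)) (EuclideanHalfSpace 1)

/-- The model with corners of `(m+1)`-dimensional manifolds with boundary, on `ℝᵐ × [0, ∞)`. -/
noncomputable abbrev halfBoxModel (m : ℕ) :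
    ModelWithCorners ℝ (EuclideanSpace ℝ (Fin m) × EuclideanSpace ℝ (Fin 1)) (HalfBox m) :=
  (𝓡 m).prod (𝓡∂ 1)

/-- A smooth codimension-one foliation, tangent to the boundary, of an `(m+1)`-dimensional manifold
with boundary: a foliated atlas. Each chart `φ = (x, y)` takes values in `ℝᵐ × [0, ∞)`, its plaques
`y = const` are connected, and changes of charts have locally the form
`(x, y) ↦ (α (x, y), γ y)`. -/
structure CodimOneFoliation (m : ℕ) (M : Type*) [TopologicalSpace M]
    [ChartedSpace (HalfBox m) M] where
  charts : Set (OpenPartialHomeomorph M (HalfBox m))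
  smooth : charts ⊆ IsManifold.maximalAtlas (halfBoxModel m) ∞ M
  cover : ∀ p : M, ∃ φ ∈ charts, p ∈ φ.source
  plaque_connected : ∀ φ ∈ charts, ∀ c : EuclideanHalfSpace 1,
    IsPreconnected {p | p ∈ φ.source ∧ (φ p).2 = c}
  compatible : ∀ φ ∈ charts, ∀ φ' ∈ charts, ∀ p ∈ φ.source ∩ φ'.source,
    ∃ γ : EuclideanHalfSpace 1 → EuclideanHalfSpace 1, ∀ᶠ q in 𝓝 p, (φ' q).2 = γ (φ q).2

namespace CodimOneFoliation

section Topological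

variable {m : ℕ} {M : Type*} [TopologicalSpace M] [ChartedSpace (HalfBox m) M]

/-- The points `p` and `q` lie in a common plaque of the foliated atlas. -/
def SamePlaque (F : CodimOneFoliation m M) (p q : M) : Prop :=
  ∃ φ ∈ F.charts, p ∈ φ.source ∧ q ∈ φ.source ∧ (φ p).2 = (φ q).2

/-- Two points lie in the same leaf if they are joined by a finite chain of plaques. -/
def leafSetoid (F : CodimOneFoliation m M) : Setoid M :=
  Relation.EqvGen.setoid F.SamePlaque

/-- The set of leaves. -/
def LeafSpace (F : CodimOneFoliation m M) : Type _ :=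
  Quotient F.leafSetoid

/-- The leaf through a point. -/
def leafOf (F : CodimOneFoliation m M) (p : M) : F.LeafSpace :=
  Quotient.mk F.leafSetoid p

/-- A leaf as a subset of the manifold. -/
def carrier (F : CodimOneFoliation m M) (L : F.LeafSpace) : Set M :=
  {p | F.leafOf p = L}

/-- A leaf contained in the boundary of the manifold. -/
def IsBoundaryLeaf (F : CodimOneFoliation m M) (L : F.LeafSpace) : Prop :=
  F.carrier L ⊆ (halfBoxModel m).boundary M

theorem carrier_nonempty (F : CodimOneFoliation m M) (L : F.LeafSpace) :
    (F.carrier L).Nonempty :=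
  Quotient.inductionOn L fun p => ⟨p, rfl⟩

/-- `(M, F, pr)` is a foliated `I`-bundle over the manifold without boundary `B`: `pr` is a smooth
fibre bundle with fibre `I = [0, 1]`, and the foliation is transverse to the fibres, that is,
`T_p M` is the direct sum of the tangent space of the leaf and of the tangent space of the
fibre at every point `p`. -/
structure IsFoliatedIBundle {B : Type*} [TopologicalSpace B]
    [ChartedSpace (EuclideanSpace ℝ (Fin m)) B]
    (F : CodimOneFoliation m M) (pr : M → B) : Prop where
  locally_trivial : ∀ b : B, ∃ e : Trivialization (Icc (0 : ℝ) 1) pr, b ∈ e.baseSet ∧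
    ContMDiffOn (halfBoxModel m) ((𝓡 m).prod (𝓡∂ 1)) ∞ e e.source ∧
    ContMDiffOn ((𝓡 m).prod (𝓡∂ 1)) (halfBoxModel m) ∞ e.toOpenPartialHomeomorph.symm e.target
  transverse : ∀ φ ∈ F.charts, ∀ p ∈ φ.source,
    IsCompl
      (mfderiv (halfBoxModel m) (𝓡∂ 1) (fun q => (φ q).2) p).ker
      (mfderiv (halfBoxModel m) (𝓡 m) pr p).ker

end Topological

section Metric

variable {m : ℕ} {M : Type*} [MetricSpace M] [ChartedSpace (HalfBox m) M]

/-- `dist (L, L')`: the infimum of the distances between a point of `L` and a point of `L'`. -/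
noncomputable def leafDist (F : CodimOneFoliation m M) (L L' : F.LeafSpace) : ℝ :=
  ⨅ x : F.carrier L × F.carrier L', dist (x.1 : M) (x.2 : M)

/-- `s` is the sum of the distances of consecutive leaves in a finite sequence of leaves that
starts at `L` and ends at `L'`. -/
def IsChainLength (F : CodimOneFoliation m M) (L L' : F.LeafSpace) (s : ℝ) : Prop :=
  ∃ (n : ℕ) (c : ℕ → F.LeafSpace), c 0 = L ∧ c n = L' ∧
    s = ∑ i ∈ Finset.range n, F.leafDist (c i) (c (i + 1))

/-- `ρ (L, L')`: the infimum of the lengths of finite sequences of leaves from `L` to `L'`. -/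
noncomputable def rho (F : CodimOneFoliation m M) (L L' : F.LeafSpace) : ℝ :=
  sInf {s | F.IsChainLength L L' s}

theorem leafDist_nonneg (F : CodimOneFoliation m M) (L L' : F.LeafSpace) : 0 ≤ F.leafDist L L' :=
  Real.iInf_nonneg fun _ => dist_nonneg

theorem leafDist_comm (F : CodimOneFoliation m M) (L L' : F.LeafSpace) :
    F.leafDist L L' = F.leafDist L' L :=
  (Equiv.prodComm (F.carrier L) (F.carrier L')).iInf_congr fun _ => dist_comm _ _

theorem IsChainLength.nonneg {F : CodimOneFoliation m M} {L L' : F.LeafSpace} {s : ℝ}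
    (h : F.IsChainLength L L' s) : 0 ≤ s := by
  obtain ⟨n, c, -, -, rfl⟩ := h
  exact Finset.sum_nonneg fun _ _ => F.leafDist_nonneg _ _

theorem IsChainLength.symm {F : CodimOneFoliation m M} {L L' : F.LeafSpace} {s : ℝ}
    (h : F.IsChainLength L L' s) : F.IsChainLength L' L s := by
  obtain ⟨n, c, h0, hn, rfl⟩ := h
  refine ⟨n, fun i => c (n - i), by simpa using hn, by simpa using h0, ?_⟩
  rw [← Finset.sum_range_reflect]
  refine Finset.sum_congr rfl fun i hi => ?_
  have hi : i < n := Finset.mem_range.1 hi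
  rw [F.leafDist_comm]
  congr 2 <;> omega

theorem IsChainLength.trans {F : CodimOneFoliation m M} {L L' L'' : F.LeafSpace} {s t : ℝ}
    (h : F.IsChainLength L L' s) (h' : F.IsChainLength L' L'' t) :
    F.IsChainLength L L'' (s + t) := by
  obtain ⟨n, c, h0, hn, rfl⟩ := h
  obtain ⟨k, d, h0', hk, rfl⟩ := h'
  refine ⟨n + k, fun i => if i ≤ n then c i else d (i - n), by simpa using h0, ?_, ?_⟩
  · by_cases hk0 : k = 0
    · subst hk0
      simp [hn, ← hk, h0']
    · simp [hk0, hk]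
  · rw [Finset.sum_range_add]
    congr 1
    · refine Finset.sum_congr rfl fun i hi => ?_
      have hi : i < n := Finset.mem_range.1 hi
      simp [hi.le, Nat.succ_le_of_lt hi]
    · refine Finset.sum_congr rfl fun i _ => ?_
      have h1 : ¬ n + i + 1 ≤ n := by omega
      have h2 : n + i + 1 - n = i + 1 := by omega
      by_cases hi0 : i = 0
      · subst hi0
        simp [hn, h0']
      · simp [hi0, h1, h2]

theorem isChainLength_nonempty (F : CodimOneFoliation m M) (L L' : F.LeafSpace) :
    {s | F.IsChainLength L L' s}.Nonempty :=
  ⟨_, 1, fun i => if i = 0 then L else L', by simp, by simp, rfl⟩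

theorem bddBelow_isChainLength (F : CodimOneFoliation m M) (L L' : F.LeafSpace) :
    BddBelow {s | F.IsChainLength L L' s} :=
  ⟨0, fun _ hs => hs.nonneg⟩

theorem rho_self (F : CodimOneFoliation m M) (L : F.LeafSpace) : F.rho L L = 0 :=
  le_antisymm (csInf_le (F.bddBelow_isChainLength L L) ⟨0, fun _ => L, rfl, rfl, by simp⟩)
    (Real.sInf_nonneg fun _ hs => hs.nonneg)

theorem rho_comm (F : CodimOneFoliation m M) (L L' : F.LeafSpace) : F.rho L L' = F.rho L' L := by
  unfold rho
  congr 1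
  ext s
  exact ⟨fun h => h.symm, fun h => h.symm⟩

theorem rho_triangle (F : CodimOneFoliation m M) (L L' L'' : F.LeafSpace) :
    F.rho L L'' ≤ F.rho L L' + F.rho L' L'' := by
  refine le_of_forall_pos_le_add fun ε hε => ?_
  obtain ⟨s, hs, hs'⟩ := exists_lt_of_csInf_lt (F.isChainLength_nonempty L L')
    (lt_add_of_pos_right (F.rho L L') (half_pos hε))
  obtain ⟨t, ht, ht'⟩ := exists_lt_of_csInf_lt (F.isChainLength_nonempty L' L'')
    (lt_add_of_pos_right (F.rho L' L'') (half_pos hε))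
  have h : F.rho L L'' ≤ s + t := csInf_le (F.bddBelow_isChainLength L L'') (hs.trans ht)
  linarith

/-- The pseudo-metric `ρ` on the set of leaves. -/
noncomputable instance leafSpacePseudoMetric (F : CodimOneFoliation m M) :
    PseudoMetricSpace F.LeafSpace where
  dist := F.rho
  dist_self := F.rho_self
  dist_comm := F.rho_comm
  dist_triangle := F.rho_triangle

/-- The Hausdorff leaf space: the quotient of `(LeafSpace, ρ)` by the relation `ρ (L, L') = 0`,
with the metric induced by `ρ`. -/
abbrev HausdorffLeafSpace (F : CodimOneFoliation m M) : Type _ :=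
  SeparationQuotient F.LeafSpace

/-- The class of a leaf in the Hausdorff leaf space. -/
noncomputable def toHLS (F : CodimOneFoliation m M) (L : F.LeafSpace) : F.HausdorffLeafSpace :=
  SeparationQuotient.mk L

end Metric

end CodimOneFoliation

/-!
The leaves are compared on the fibres of `pr`, which are intervals. The fibres being compact, every
point `b` of the base has a neighbourhood over which the foliation is a product: a *flat chart*
(`IsFlatChart`, `exists_isFlatChart`) is a function `T` that transports the points near the fibre
over `b` along the leaves to this fibre. Transversality makes the transverse coordinate of a
foliated chart strictly monotone along the fibres (`injOn_height_fibre`, by Rolle's theorem), which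
gives transports near each point of the fibre (`exists_local_transport`); they are unique as germs
(`IsTransportAt.eventuallyEq`) and are glued from the bottom of the fibre to its top
(`hasTransport_one`). That the foliation is tangent to the boundary enters through the fact that
foliated charts and trivializations both detect the boundary of `M`
(`mem_boundary_iff_height`, `mem_boundary_iff_triv`): hence the ends of a fibre are transported to
the ends of the nearby fibres.

Say that `p` is joined to the leaf `A` off the leaf `L` if a segment of the fibre through `p` leads
from `p` to a point of `A` without meeting `L` (`IsJoined`). In a flat chart this depends only on
the heights, so it is constant along the leaves (`isJoined_iff_of_leafOf_eq`) and along the paths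
that do not meet `L` (`isLocallyConstant_isJoined`). Let `L₀` be a boundary leaf. If points of `L'`
were joined to `L₀` off `L` and points of `L` were joined to `L₀` off `L'`, then, moving along `L₀`,
both segments could be taken on one fibre, starting at the same end; but the
nearer of their other ends lies on both segments (`not_isJoined_of_isJoined`).

So one of the leaves, say `L`, separates `L₀` from `L'`. A chain of leaves from `L₀` to `L'`, its
gaps being filled by almost shortest paths, crosses `L`, whence `ρ (L₀, L) + ρ (L, L') ≤ ρ (L₀, L')`
(`rho_add_rho_le_rho`). Therefore `ρ (L, L') = |ρ (L₀, L) - ρ (L₀, L')|` (`rho_eq_abs_sub`), that is,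
the distance to `L₀` embeds the Hausdorff leaf space isometrically into the line. The image is
compact and connected, as `M` is, and contains `0`.
-/

/-! ### Transverse coordinates and the boundary -/

namespace CodimOneFoliation

section Height

variable {m : ℕ} {M : Type*} [TopologicalSpace M]

/-- The transverse coordinate of a foliated chart, as a real number. -/
noncomputable def height (φ : OpenPartialHomeomorph M (HalfBox m)) (p : M) : ℝ :=
  (φ p).2.1 0

theorem height_eq_iff {φ φ' : OpenPartialHomeomorph M (HalfBox m)} {p q : M} :
    height φ p = height φ' q ↔ (φ p).2 = (φ' q).2 := by
  refine ⟨fun h => ?_, fun h => by simp [height, h]⟩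
  apply Subtype.ext
  ext i
  rw [Subsingleton.elim i 0]
  exact h

theorem continuousOn_height (φ : OpenPartialHomeomorph M (HalfBox m)) :
    ContinuousOn (height φ) φ.source := by
  have h1 : Continuous fun z : HalfBox m => (z.2.1 0 : ℝ) := by
    have : Continuous fun z : HalfBox m => z.2 := continuous_snd
    fun_prop
  exact h1.comp_continuousOn φ.continuousOn

theorem contMDiff_snd_halfBox (m : ℕ) :
    ContMDiff (halfBoxModel m) (𝓡∂ 1) ∞ (fun z : HalfBox m => z.2) := by
  have h := contMDiff_snd (I := 𝓡 m) (J := 𝓡∂ 1) (n := ∞) (M := EuclideanSpace ℝ (Fin m))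
    (N := EuclideanHalfSpace 1)
  rw [chartedSpaceSelf_prod] at h
  exact h

/-- Whether a point lies on the boundary can be tested in any foliated chart. -/
theorem mem_boundary_iff_height [ChartedSpace (HalfBox m) M] [IsManifold (halfBoxModel m) ∞ M]
    (F : CodimOneFoliation m M)
    {φ : OpenPartialHomeomorph M (HalfBox m)} (hφ : φ ∈ F.charts) {p : M} (hp : p ∈ φ.source) :
    p ∈ (halfBoxModel m).boundary M ↔ height φ p = 0 := by
  have hmax := F.smooth hφ
  have hloc : IsLocalDiffeomorphAt (halfBoxModel m) (halfBoxModel m) ∞ φ p :=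
    ⟨{ φ with
        contMDiffOn_toFun := contMDiffOn_of_mem_maximalAtlas hmax
        contMDiffOn_invFun := contMDiffOn_symm_of_mem_maximalAtlas hmax }, hp, fun _ _ => rfl⟩
  have h1 := hloc.isBoundaryPoint_iff (by simp)
  refine h1.trans ?_
  change φ p ∈ (halfBoxModel m).boundary (HalfBox m) ↔ _
  rw [show (halfBoxModel m).boundary (HalfBox m) = _ from
    ModelWithCorners.boundary_of_boundaryless_left]
  change _ ∧ _ ↔ _
  simp only [mem_univ, true_and]
  change (𝓡∂ 1).IsBoundaryPoint _ ↔ _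
  rw [ModelWithCorners.isBoundaryPoint_iff, frontier_range_modelWithCornersEuclideanHalfSpace]
  exact eq_comm

end Height

section Trivialization

variable {m : ℕ} {B M : Type*} [TopologicalSpace B] [ChartedSpace (EuclideanSpace ℝ (Fin m)) B]
  [TopologicalSpace M] [ChartedSpace (HalfBox m) M] {pr : M → B}

/-- The local trivialization `e` of an interval bundle is a diffeomorphism. -/
structure IsSmoothTriv (m : ℕ) {B M : Type*} [TopologicalSpace B]
    [ChartedSpace (EuclideanSpace ℝ (Fin m)) B] [TopologicalSpace M] [ChartedSpace (HalfBox m) M]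
    {pr : M → B} (e : Trivialization (Icc (0 : ℝ) 1) pr) : Prop where
  smooth : ContMDiffOn (halfBoxModel m) ((𝓡 m).prod (𝓡∂ 1)) ∞ e e.source
  smooth_symm :
    ContMDiffOn ((𝓡 m).prod (𝓡∂ 1)) (halfBoxModel m) ∞ e.toOpenPartialHomeomorph.symm e.target

theorem mem_boundary_iff_triv {e : Trivialization (Icc (0 : ℝ) 1) pr} (he : IsSmoothTriv m e)
    {p : M} (hp : p ∈ e.source) :
    p ∈ (halfBoxModel m).boundary M ↔ (e p).2 = 0 ∨ (e p).2 = 1 := by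
  have hloc : IsLocalDiffeomorphAt (halfBoxModel m) ((𝓡 m).prod (𝓡∂ 1)) ∞ e p :=
    ⟨{ e.toOpenPartialHomeomorph with
        contMDiffOn_toFun := he.smooth
        contMDiffOn_invFun := he.smooth_symm }, hp, fun _ _ => rfl⟩
  refine (hloc.isBoundaryPoint_iff (by simp)).trans ?_
  change e p ∈ ((𝓡 m).prod (𝓡∂ 1)).boundary (B × Icc (0 : ℝ) 1) ↔ _
  rw [boundary_product]
  change _ ∧ _ ↔ _
  simp only [mem_univ, true_and]
  exact Iff.rfl

/-- Transversality: along the fibres, the transverse coordinate of a foliated chart has non-zero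
derivative, since the tangent vector of the fibre lies in the kernel of the differential of `pr`.
Here `c` is not an end of `[0, 1]`. -/
theorem deriv_height_ne_zero {F : CodimOneFoliation m M} (hF : F.IsFoliatedIBundle pr)
    {φ : OpenPartialHomeomorph M (HalfBox m)} (hφ : φ ∈ F.charts)
    {e : Trivialization (Icc (0 : ℝ) 1) pr} (he : IsSmoothTriv m e) {b : B} (hb : b ∈ e.baseSet)
    {c : ℝ} (hc : c ∈ Ioo (0 : ℝ) 1)
    (hp : e.toOpenPartialHomeomorph.symm (b, projIcc 0 1 zero_le_one c) ∈ φ.source) :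
    deriv (fun s => height φ (e.toOpenPartialHomeomorph.symm (b, projIcc 0 1 zero_le_one s))) c
      ≠ 0 := by
  set γ : ℝ → M := fun s => e.toOpenPartialHomeomorph.symm (b, projIcc 0 1 zero_le_one s) with hγ
  have hnhds : Icc (0 : ℝ) 1 ∈ 𝓝 c := Icc_mem_nhds hc.1 hc.2
  have hproj : ContMDiffAt 𝓘(ℝ) (𝓡∂ 1) ∞ (projIcc (0 : ℝ) 1 zero_le_one) c :=
    contMDiffOn_projIcc.contMDiffAt hnhds
  have htar : ∀ s : ℝ, (b, projIcc 0 1 zero_le_one s) ∈ e.target := fun s =>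
    e.mem_target.2 hb
  have hγs : ContMDiffAt 𝓘(ℝ) (halfBoxModel m) ∞ γ c := by
    have h1 := he.smooth_symm.contMDiffAt (e.open_target.mem_nhds (htar c))
    exact h1.comp c (contMDiffAt_const.prodMk hproj)
  have hγd := hγs.mdifferentiableAt (by simp)
  have hsrc : γ c ∈ e.source := e.toOpenPartialHomeomorph.map_target (htar c)
  have hes := he.smooth.contMDiffAt (e.open_source.mem_nhds hsrc)
  have heγ : ∀ s, e (γ s) = (b, projIcc 0 1 zero_le_one s) := fun s =>
    e.apply_symm_apply (htar s)
  have hprs : MDifferentiableAt (halfBoxModel m) (𝓡 m) pr (γ c) := by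
    have h1 : ContMDiffAt (halfBoxModel m) (𝓡 m) ∞ (fun q => (e q).1) (γ c) :=
      contMDiffAt_fst.comp _ hes
    refine (h1.congr_of_eventuallyEq ?_).mdifferentiableAt (by simp)
    filter_upwards [e.open_source.mem_nhds hsrc] with q hq using (e.coe_fst hq).symm
  set v : TangentSpace (halfBoxModel m) (γ c) := mfderiv 𝓘(ℝ) (halfBoxModel m) γ c (1 : ℝ) with hv
  have hv1 : mfderiv (halfBoxModel m) (𝓡 m) pr (γ c) v = 0 := by
    have h1 := mfderiv_comp c hprs hγd
    have h2 : pr ∘ γ = fun _ => b := by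
      funext s
      exact e.proj_symm_apply (htar s)
    rw [h2, mfderiv_const] at h1
    exact (congrArg (fun f => f (1 : ℝ)) h1).symm
  have hv0 : v ≠ 0 := by
    intro h0
    have h1 : ContMDiffAt (halfBoxModel m) 𝓘(ℝ) ∞ (fun q => ((e q).2 : ℝ)) (γ c) :=
      contMDiff_subtypeVal_Icc.contMDiffAt.comp _ (contMDiffAt_snd.comp _ hes)
    have h2 := mfderiv_comp c (h1.mdifferentiableAt (by simp)) hγd
    have h3 : (fun q => ((e q).2 : ℝ)) ∘ γ =ᶠ[𝓝 c] id := by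
      filter_upwards [hnhds] with s hs
      simp [heγ, projIcc_of_mem zero_le_one hs]
    rw [h3.mfderiv_eq, mfderiv_id] at h2
    have h4 := congrArg (fun f => f (1 : ℝ)) h2
    change (1 : ℝ) = mfderiv (halfBoxModel m) 𝓘(ℝ) (fun q => ((e q).2 : ℝ)) (γ c) v at h4
    rw [h0, map_zero] at h4
    exact one_ne_zero (α := ℝ) h4
  have hys : ContMDiffAt (halfBoxModel m) (𝓡∂ 1) ∞ (fun q => (φ q).2) (γ c) :=
    (contMDiff_snd_halfBox m).contMDiffAt.comp (γ c)
      (contMDiffAt_of_mem_maximalAtlas (F.smooth hφ) hp)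
  -- the tangent vector `v` of the fibre is not tangent to the leaf
  have hw : mfderiv (halfBoxModel m) (𝓡∂ 1) (fun q => (φ q).2) (γ c) v ≠ 0 := fun h =>
    hv0 ((Submodule.disjoint_def.1 (hF.transverse φ hφ _ hp).disjoint) v h hv1)
  intro hd
  apply hw
  have h1 := mfderiv_comp c (hys.mdifferentiableAt (by simp)) hγd
  have h2 : mfderiv 𝓘(ℝ) (𝓡∂ 1) ((fun q => (φ q).2) ∘ γ) c (1 : ℝ) =
      mfderiv (halfBoxModel m) (𝓡∂ 1) (fun q => (φ q).2) (γ c) v := by rw [h1]; rfl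
  rw [← h2]
  have h3 := (hys.comp c hγs).mdifferentiableAt (by simp)
  -- the differential of a map between model spaces is an ordinary derivative
  obtain ⟨D, hD, hD1⟩ : ∃ D : ℝ →L[ℝ] EuclideanSpace ℝ (Fin 1),
      HasFDerivAt (fun s => (φ (γ s)).2.1) D c ∧
        mfderiv 𝓘(ℝ) (𝓡∂ 1) ((fun q => (φ q).2) ∘ γ) c (1 : ℝ) = D 1 := by
    refine ⟨mfderiv 𝓘(ℝ) (𝓡∂ 1) ((fun q => (φ q).2) ∘ γ) c, ?_, rfl⟩
    have h5 := h3.hasMFDerivAt.2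
    simp only [mfld_simps] at h5
    exact HasFDerivWithinAt.hasFDerivAt h5 univ_mem
  rw [hD1]
  have h6 := ((EuclideanSpace.proj (𝕜 := ℝ) (0 : Fin 1)).hasFDerivAt.comp c hD).hasDerivAt
  have h7 := h6.deriv.symm.trans hd
  change D 1 = (0 : EuclideanSpace ℝ (Fin 1))
  ext i
  rw [Subsingleton.elim i 0]
  exact h7

/-- By Rolle's theorem, the transverse coordinate of a foliated chart is injective on the segments
of the fibres that lie in the domain of the chart. -/
theorem injOn_height_fibre {F : CodimOneFoliation m M} (hF : F.IsFoliatedIBundle pr)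
    {φ : OpenPartialHomeomorph M (HalfBox m)} (hφ : φ ∈ F.charts)
    {e : Trivialization (Icc (0 : ℝ) 1) pr} (he : IsSmoothTriv m e) {b : B} (hb : b ∈ e.baseSet)
    {J : Set (Icc (0 : ℝ) 1)} (hJ : J.OrdConnected)
    (hp : ∀ u ∈ J, e.toOpenPartialHomeomorph.symm (b, u) ∈ φ.source) :
    InjOn (fun u => height φ (e.toOpenPartialHomeomorph.symm (b, u))) J := by
  have key : ∀ u ∈ J, ∀ v ∈ J, u < v →
      height φ (e.toOpenPartialHomeomorph.symm (b, u)) ≠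
        height φ (e.toOpenPartialHomeomorph.symm (b, v)) := by
    intro u hu v hv huv heq
    have hproj : ∀ s ∈ Icc (u : ℝ) v, projIcc 0 1 zero_le_one s ∈ J := by
      intro s hs
      refine hJ.out hu hv ⟨?_, ?_⟩
      · rw [← projIcc_val zero_le_one u]
        exact monotone_projIcc _ hs.1
      · rw [← projIcc_val zero_le_one v]
        exact monotone_projIcc _ hs.2
    have hcont : ContinuousOn
        (fun s => height φ (e.toOpenPartialHomeomorph.symm (b, projIcc 0 1 zero_le_one s)))
        (Icc (u : ℝ) v) := by
      refine (continuousOn_height φ).comp (e.toOpenPartialHomeomorph.continuousOn_symm.comp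
        (f := fun s => (b, projIcc 0 1 zero_le_one s)) (by fun_prop) ?_) ?_
      · exact fun s _ => e.mem_target.2 hb
      · exact fun s hs => hp _ (hproj s hs)
    obtain ⟨c, hc, hd⟩ := exists_deriv_eq_zero (Subtype.coe_lt_coe.2 huv) hcont
      (by simpa only [projIcc_val] using heq)
    exact deriv_height_ne_zero hF hφ he hb ⟨u.2.1.trans_lt hc.1, hc.2.trans_le v.2.2⟩
      (hp _ (hproj c ⟨hc.1.le, hc.2.le⟩)) hd
  intro u hu v hv heq
  rcases lt_trichotomy u v with h | h | h
  · exact (key u hu v hv h heq).elim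
  · exact h
  · exact (key v hv u hu h heq.symm).elim

end Trivialization

end CodimOneFoliation

/-! ### Flat charts -/

/-- A continuous strictly increasing function on a segment has a continuous inverse. -/
theorem exists_inverse_of_strictMonoOn {f : Icc (0 : ℝ) 1 → ℝ} {a c : Icc (0 : ℝ) 1} (hac : a ≤ c)
    (hf : ContinuousOn f (Icc a c)) (hmono : StrictMonoOn f (Icc a c)) :
    ∃ G : ℝ → Icc (0 : ℝ) 1, ContinuousOn G (Icc (f a) (f c)) ∧
      StrictMonoOn G (Icc (f a) (f c)) ∧ (∀ u ∈ Icc a c, G (f u) = u) ∧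
      ∀ r ∈ Icc (f a) (f c), G r ∈ Icc a c ∧ f (G r) = r := by
  have hsurj : ∀ r ∈ Icc (f a) (f c), ∃ u ∈ Icc a c, f u = r := intermediate_value_Icc hac hf
  choose! G hG hfG using hsurj
  have hmaps : ∀ u ∈ Icc a c, f u ∈ Icc (f a) (f c) := fun u hu =>
    ⟨hmono.monotoneOn (left_mem_Icc.2 hac) hu hu.1, hmono.monotoneOn hu (right_mem_Icc.2 hac) hu.2⟩
  have hleft : ∀ u ∈ Icc a c, G (f u) = u := fun u hu =>
    hmono.injOn (hG _ (hmaps u hu)) hu (hfG _ (hmaps u hu))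
  have hGmono : StrictMonoOn G (Icc (f a) (f c)) := fun r hr s hs hrs =>
    (hmono.lt_iff_lt (hG r hr) (hG s hs)).1 (by rwa [hfG r hr, hfG s hs])
  refine ⟨G, ?_, hGmono, hleft, fun r hr => ⟨hG r hr, hfG r hr⟩⟩
  have hcont : Continuous (fun r : Icc (f a) (f c) => (⟨G r, hG r r.2⟩ : Icc a c)) := by
    refine Monotone.continuous_of_surjective (fun r s hrs => hGmono.monotoneOn r.2 s.2 hrs) ?_
    exact fun u => ⟨⟨f u, hmaps u u.2⟩, Subtype.ext (hleft u u.2)⟩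
  rw [continuousOn_iff_continuous_domRestrict]
  exact continuous_subtype_val.comp hcont

theorem eq_zero_of_Icc_mem_nhds_left {s t : Icc (0 : ℝ) 1} (h : Icc s t ∈ 𝓝 s) : s = 0 := by
  by_contra h0
  have h1 : 0 < s := lt_of_le_of_ne' s.2.1 h0
  obtain ⟨l, hl, hls⟩ := exists_Ioc_subset_of_mem_nhds h ⟨0, h1⟩
  obtain ⟨x, hx, hx'⟩ := exists_between hl
  exact (hls ⟨hx, hx'.le⟩).1.not_gt hx'

theorem eq_one_of_Icc_mem_nhds_right {s t : Icc (0 : ℝ) 1} (h : Icc t s ∈ 𝓝 s) : s = 1 := by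
  by_contra h0
  have h1 : s < 1 := lt_of_le_of_ne s.2.2 h0
  obtain ⟨l, hl, hls⟩ := exists_Ico_subset_of_mem_nhds h ⟨1, h1⟩
  obtain ⟨x, hx, hx'⟩ := exists_between hl
  exact (hls ⟨hx.le, hx'⟩).2.not_gt hx

namespace CodimOneFoliation

section Germ

variable {m : ℕ} {B M : Type*} [TopologicalSpace B] [TopologicalSpace M]
  [ChartedSpace (HalfBox m) M] {pr : M → B}

/-- The germ at `x` of a transport along the leaves, in the coordinates of a trivialization: `T`
sends a point to the height at which its leaf meets the fibre over `b`, and it is locally a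
function of the transverse coordinate of the foliated charts. -/
structure IsTransportAt (F : CodimOneFoliation m M) (e : Trivialization (Icc (0 : ℝ) 1) pr) (b : B)
    (T : B × Icc (0 : ℝ) 1 → Icc (0 : ℝ) 1) (x : B × Icc (0 : ℝ) 1) : Prop where
  continuousAt : ContinuousAt T x
  leafOf_eq : F.leafOf (e.toOpenPartialHomeomorph.symm x) =
    F.leafOf (e.toOpenPartialHomeomorph.symm (b, T x))
  factors : ∀ φ ∈ F.charts, e.toOpenPartialHomeomorph.symm x ∈ φ.source →
    ∃ γ : EuclideanHalfSpace 1 → Icc (0 : ℝ) 1,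
      ∀ᶠ y in 𝓝 x, T y = γ (φ (e.toOpenPartialHomeomorph.symm y)).2

theorem IsTransportAt.congr {F : CodimOneFoliation m M} {e : Trivialization (Icc (0 : ℝ) 1) pr}
    {b : B} {T T' : B × Icc (0 : ℝ) 1 → Icc (0 : ℝ) 1} {x : B × Icc (0 : ℝ) 1}
    (h : IsTransportAt F e b T x) (hT : T' =ᶠ[𝓝 x] T) : IsTransportAt F e b T' x where
  continuousAt := h.continuousAt.congr hT.symm
  leafOf_eq := by rw [hT.eq_of_nhds]; exact h.leafOf_eq
  factors φ hφ hx := by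
    obtain ⟨γ, hγ⟩ := h.factors φ hφ hx
    refine ⟨γ, ?_⟩
    filter_upwards [hγ, hT] with y hy hy' using hy'.trans hy

/-- `HasTransport F e b s`: the transport to the fibre over `b` along the leaves is defined on a
neighbourhood of the part of this fibre below `s`. -/
def HasTransport (F : CodimOneFoliation m M) (e : Trivialization (Icc (0 : ℝ) 1) pr) (b : B)
    (s : Icc (0 : ℝ) 1) : Prop :=
  ∃ T : B × Icc (0 : ℝ) 1 → Icc (0 : ℝ) 1, (∀ u ≤ s, ∀ᶠ u' in 𝓝 u, T (b, u') = u') ∧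
    ∀ᶠ b' in 𝓝 b, StrictMonoOn (fun u => T (b', u)) (Iic s) ∧ T (b', 0) = 0 ∧
      (s = 1 → T (b', 1) = 1) ∧ ∀ u ≤ s, IsTransportAt F e b T (b', u)

theorem HasTransport.mono {F : CodimOneFoliation m M} {e : Trivialization (Icc (0 : ℝ) 1) pr}
    {b : B} {s t : Icc (0 : ℝ) 1} (hst : s ≤ t) (h : HasTransport F e b t) :
    HasTransport F e b s := by
  obtain ⟨T, hT, hev⟩ := h
  refine ⟨T, fun u hu => hT u (hu.trans hst), hev.mono fun b' hb' => ?_⟩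
  exact ⟨hb'.1.mono (Iic_subset_Iic.2 hst), hb'.2.1,
    fun h1 => hb'.2.2.1 (le_antisymm t.2.2 (h1 ▸ hst)), fun u hu => hb'.2.2.2 u (hu.trans hst)⟩

end Germ

variable {m : ℕ} {B M : Type*} [TopologicalSpace B] [ChartedSpace (EuclideanSpace ℝ (Fin m)) B]
  [TopologicalSpace M] [ChartedSpace (HalfBox m) M] [IsManifold (halfBoxModel m) ∞ M] {pr : M → B}

/-- A foliated box in the coordinates of a smooth trivialization: near a point `(b, s)` the
transverse coordinate of a foliated chart is, up to the factor `σ`, strictly increasing along the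
fibres, and its values near `(b, s)` are already taken on the fibre over `b`. -/
theorem exists_foliated_box {F : CodimOneFoliation m M} (hF : F.IsFoliatedIBundle pr)
    {φ : OpenPartialHomeomorph M (HalfBox m)} (hφ : φ ∈ F.charts)
    {e : Trivialization (Icc (0 : ℝ) 1) pr} (he : IsSmoothTriv m e) {b : B} (hb : b ∈ e.baseSet)
    {s : Icc (0 : ℝ) 1} (hs : e.toOpenPartialHomeomorph.symm (b, s) ∈ φ.source)
    {N : Set (Icc (0 : ℝ) 1)} (hN : N ∈ 𝓝 s) :
    ∃ (σ : ℝ) (a c : Icc (0 : ℝ) 1) (k : B × Icc (0 : ℝ) 1 → ℝ), σ ≠ 0 ∧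
      (∀ x, k x = σ * height φ (e.toOpenPartialHomeomorph.symm x)) ∧
      s ∈ Icc a c ∧ Icc a c ∈ 𝓝 s ∧ Icc a c ⊆ N ∧
      (∀ u ∈ Icc a c, e.toOpenPartialHomeomorph.symm (b, u) ∈ φ.source) ∧
      ContinuousOn (fun u => k (b, u)) (Icc a c) ∧
      StrictMonoOn (fun u => k (b, u)) (Icc a c) ∧
      ∀ᶠ x in 𝓝 ((b, s) : B × Icc (0 : ℝ) 1),
        x.1 ∈ e.baseSet ∧ x.2 ∈ Icc a c ∧
        e.toOpenPartialHomeomorph.symm x ∈ φ.source ∧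
        StrictMonoOn (fun u => k (x.1, u)) (Icc a c) ∧
        k x ∈ Icc (k (b, a)) (k (b, c)) ∧ ContinuousAt k x := by
  have htar : ∀ x : B × Icc (0 : ℝ) 1, x.1 ∈ e.baseSet → x ∈ e.target := fun x hx =>
    e.mem_target.2 hx
  -- the domain of the chart in the coordinates of the trivialization
  set W : Set (B × Icc (0 : ℝ) 1) :=
    e.target ∩ e.toOpenPartialHomeomorph.symm ⁻¹' φ.source with hW
  have hWo : IsOpen W := e.toOpenPartialHomeomorph.symm.isOpen_inter_preimage φ.open_source
  have hsW : (b, s) ∈ W := ⟨htar _ hb, hs⟩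
  have hhW : ContinuousOn (fun x => height φ (e.toOpenPartialHomeomorph.symm x)) W :=
    (continuousOn_height φ).comp (e.toOpenPartialHomeomorph.continuousOn_symm.mono
      inter_subset_left) fun x hx => hx.2
  obtain ⟨V, hV, N', hN', hVN⟩ := mem_nhds_prod_iff.1 (hWo.mem_nhds hsW)
  obtain ⟨a, c, hsac, hacs, hacN⟩ := exists_Icc_mem_subset_of_mem_nhds (inter_mem hN hN')
  have hac : a ≤ c := hsac.1.trans hsac.2
  have hbox : ∀ b' ∈ V, ∀ u ∈ Icc a c, (b', u) ∈ W := fun b' hb' u hu =>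
    hVN ⟨hb', (hacN hu).2⟩
  have hbV : b ∈ V := mem_of_mem_nhds hV
  -- `σ` is a sign that makes the transverse coordinate increasing along the fibres
  obtain ⟨σ, hσ, hσac⟩ : ∃ σ : ℝ, σ ≠ 0 ∧
      σ * height φ (e.toOpenPartialHomeomorph.symm (b, a)) ≤
        σ * height φ (e.toOpenPartialHomeomorph.symm (b, c)) := by
    rcases le_total (height φ (e.toOpenPartialHomeomorph.symm (b, a)))
      (height φ (e.toOpenPartialHomeomorph.symm (b, c))) with h | h
    · exact ⟨1, one_ne_zero, by simpa using h⟩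
    · exact ⟨-1, by norm_num, by simpa using h⟩
  set k : B × Icc (0 : ℝ) 1 → ℝ := fun x =>
    σ * height φ (e.toOpenPartialHomeomorph.symm x) with hk
  have hkW : ContinuousOn k W := continuousOn_const.mul hhW
  have hkat : ∀ x ∈ W, ContinuousAt k x := fun x hx => hkW.continuousAt (hWo.mem_nhds hx)
  have hkfib : ∀ b' ∈ V, ContinuousOn (fun u => k (b', u)) (Icc a c) := fun b' hb' =>
    hkW.comp (by fun_prop) fun u hu => hbox b' hb' u hu
  have hkinj : ∀ b' ∈ V, InjOn (fun u => k (b', u)) (Icc a c) := fun b' hb' u hu v hv huv =>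
    injOn_height_fibre hF hφ he (e.mem_target.1 (hbox b' hb' u hu).1) ordConnected_Icc
      (fun w hw => (hbox b' hb' w hw).2) hu hv (mul_left_cancel₀ hσ huv)
  have hmono : ∀ b' ∈ V, k (b', a) ≤ k (b', c) → StrictMonoOn (fun u => k (b', u)) (Icc a c) :=
    fun b' hb' h => (hkfib b' hb').strictMonoOn_of_injOn_Icc hac h (hkinj b' hb')
  have hmonob := hmono b hbV hσac
  have hev_le : ∀ᶠ b' in 𝓝 b, k (b', a) ≤ k (b', c) := by
    rcases hac.eq_or_lt with rfl | hlt
    · exact Eventually.of_forall fun _ => le_rfl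
    · have h1 := hmonob (left_mem_Icc.2 hac) (right_mem_Icc.2 hac) hlt
      have ha : ContinuousAt (fun b' => k (b', a)) b :=
        (hkat _ (hbox b hbV a (left_mem_Icc.2 hac))).comp (f := fun b' => (b', a)) (by fun_prop)
      have hc : ContinuousAt (fun b' => k (b', c)) b :=
        (hkat _ (hbox b hbV c (right_mem_Icc.2 hac))).comp (f := fun b' => (b', c)) (by fun_prop)
      exact (ha.eventually_lt hc h1).mono fun _ h => h.le
  -- at the ends of the fibres the chart takes values in the boundary
  have hend : ∀ b' ∈ V, ∀ u ∈ Icc a c, u = 0 ∨ u = 1 → k (b', u) = 0 := by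
    intro b' hb' u hu hu01
    have hW' := hbox b' hb' u hu
    have h1 : height φ (e.toOpenPartialHomeomorph.symm (b', u)) = 0 := by
      rw [← F.mem_boundary_iff_height hφ hW'.2,
        mem_boundary_iff_triv he (e.toOpenPartialHomeomorph.map_target hW'.1),
        e.apply_symm_apply hW'.1]
      exact hu01
    simp [hk, h1]
  have hfst : ∀ᶠ x in 𝓝 ((b, s) : B × Icc (0 : ℝ) 1), x.1 ∈ V ∧ k (x.1, a) ≤ k (x.1, c) :=
    (continuous_fst.tendsto ((b, s) : B × Icc (0 : ℝ) 1)).eventually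
      ((eventually_mem_set.2 hV).and hev_le)
  have hsnd : ∀ᶠ x in 𝓝 ((b, s) : B × Icc (0 : ℝ) 1), x.2 ∈ Icc a c :=
    (continuous_snd.tendsto ((b, s) : B × Icc (0 : ℝ) 1)).eventually_mem hacs
  have hlow : ∀ᶠ x in 𝓝 ((b, s) : B × Icc (0 : ℝ) 1), k (b, a) ≤ k x := by
    -- `a = s` is possible only at the lower end of the fibre
    rcases hsac.1.eq_or_lt with rfl | hlt
    · have ha0 := eq_zero_of_Icc_mem_nhds_left hacs
      filter_upwards [hfst, hsnd] with x hx hx2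
      have h1 := (hmono x.1 hx.1 hx.2).monotoneOn (left_mem_Icc.2 hac) hx2 hx2.1
      simp only [hend x.1 hx.1 a (left_mem_Icc.2 hac) (Or.inl ha0)] at h1
      rwa [hend b hbV a (left_mem_Icc.2 hac) (Or.inl ha0)]
    · have h1 := hmonob (left_mem_Icc.2 hac) hsac hlt
      exact ((hkat _ hsW).eventually (eventually_gt_nhds h1)).mono fun _ h => h.le
  have hupp : ∀ᶠ x in 𝓝 ((b, s) : B × Icc (0 : ℝ) 1), k x ≤ k (b, c) := by
    -- `s = c` is possible only at the upper end of the fibre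
    rcases hsac.2.eq_or_lt with rfl | hlt
    · have hc1 := eq_one_of_Icc_mem_nhds_right hacs
      filter_upwards [hfst, hsnd] with x hx hx2
      have h1 := (hmono x.1 hx.1 hx.2).monotoneOn hx2 (right_mem_Icc.2 hac) hx2.2
      simp only [hend x.1 hx.1 s (right_mem_Icc.2 hac) (Or.inr hc1)] at h1
      rwa [hend b hbV s (right_mem_Icc.2 hac) (Or.inr hc1)]
    · have h1 := hmonob hsac (right_mem_Icc.2 hac) hlt
      exact ((hkat _ hsW).eventually (eventually_lt_nhds h1)).mono fun _ h => h.le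
  refine ⟨σ, a, c, k, hσ, fun _ => rfl, hsac, hacs, fun u hu => (hacN hu).1,
    fun u hu => (hbox b hbV u hu).2, hkfib b hbV, hmonob, ?_⟩
  filter_upwards [hfst, hsnd, hlow, hupp] with x hx hx2 hx3 hx4
  have hxW := hbox x.1 hx.1 x.2 hx2
  exact ⟨e.mem_target.1 hxW.1, hx2, hxW.2, hmono x.1 hx.1 hx.2, ⟨hx3, hx4⟩, hkat x hxW⟩

/-- A transport to the fibre over `b` is unique near a point `(b, s)`. -/
theorem IsTransportAt.eventuallyEq {F : CodimOneFoliation m M} (hF : F.IsFoliatedIBundle pr)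
    {e : Trivialization (Icc (0 : ℝ) 1) pr} (he : IsSmoothTriv m e) {b : B} (hb : b ∈ e.baseSet)
    {s : Icc (0 : ℝ) 1} {T T' : B × Icc (0 : ℝ) 1 → Icc (0 : ℝ) 1}
    (h : IsTransportAt F e b T (b, s)) (h' : IsTransportAt F e b T' (b, s))
    (hT : ∀ᶠ u in 𝓝 s, T (b, u) = u) (hT' : ∀ᶠ u in 𝓝 s, T' (b, u) = u) :
    T =ᶠ[𝓝 (b, s)] T' := by
  obtain ⟨φ, hφ, hs⟩ := F.cover (e.toOpenPartialHomeomorph.symm (b, s))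
  obtain ⟨γ, hγ⟩ := h.factors φ hφ hs
  obtain ⟨γ', hγ'⟩ := h'.factors φ hφ hs
  -- both are functions of the same transverse coordinate, whose values near `(b, s)` are already
  -- taken on the fibre over `b`, where both are the identity
  have hfib : ContinuousAt (fun u : Icc (0 : ℝ) 1 => (b, u)) s := by fun_prop
  have hN := ((hT.and hT').and (hfib.eventually (hγ.and hγ')))
  obtain ⟨σ, a, c, k, hσ, hk, hsac, -, hacN, -, hcont, hmono, hev⟩ :=
    exists_foliated_box hF hφ he hb hs hN
  filter_upwards [hev, hγ, hγ'] with x hx hx1 hx2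
  obtain ⟨u, hu, hux⟩ := intermediate_value_Icc (hsac.1.trans hsac.2) hcont hx.2.2.2.2.1
  have hux' : (φ (e.toOpenPartialHomeomorph.symm (b, u))).2 =
      (φ (e.toOpenPartialHomeomorph.symm x)).2 := by
    rw [← height_eq_iff]
    apply mul_left_cancel₀ hσ
    simpa only [hk] using hux
  obtain ⟨⟨h1, h2⟩, h3, h4⟩ := hacN hu
  rw [hx1, hx2, ← hux', ← h3, ← h4, h1, h2]

/-- A transport to the fibre over `b` exists near every point of this fibre. -/
theorem exists_local_transport {F : CodimOneFoliation m M} (hF : F.IsFoliatedIBundle pr)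
    {e : Trivialization (Icc (0 : ℝ) 1) pr} (he : IsSmoothTriv m e) {b : B} (hb : b ∈ e.baseSet)
    (s : Icc (0 : ℝ) 1) :
    ∃ (T : B × Icc (0 : ℝ) 1 → Icc (0 : ℝ) 1) (a c : Icc (0 : ℝ) 1),
      Icc a c ∈ 𝓝 s ∧ (∀ u ∈ Icc a c, ∀ᶠ u' in 𝓝 u, T (b, u') = u') ∧
      ∀ᶠ b' in 𝓝 b, StrictMonoOn (fun u => T (b', u)) (Icc a c) ∧
        (0 ∈ Icc a c → T (b', 0) = 0) ∧ (1 ∈ Icc a c → T (b', 1) = 1) ∧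
        ∀ u ∈ Icc a c, IsTransportAt F e b T (b', u) := by
  obtain ⟨φ, hφ, hs⟩ := F.cover (e.toOpenPartialHomeomorph.symm (b, s))
  obtain ⟨σ, a, c, k, hσ, hk, hsac, hacs, -, hsrc, hcont, hmono, hev⟩ :=
    exists_foliated_box hF hφ he hb hs univ_mem
  -- the transport is `k` followed by the inverse `G` of `k` on the fibre over `b`
  obtain ⟨G, hGc, hGm, hGl, hGr⟩ :=
    exists_inverse_of_strictMonoOn (hsac.1.trans hsac.2) hcont hmono
  obtain ⟨V, N, hV, hbV, hN, hsN, hVN⟩ := mem_nhds_prod_iff'.1 hev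
  obtain ⟨a', c', -, hac', hac'N⟩ := exists_Icc_mem_subset_of_mem_nhds (hN.mem_nhds hsN)
  have hbox : ∀ b' ∈ V, ∀ u ∈ N, _ := fun b' hb' u hu => hVN (mk_mem_prod hb' hu)
  have hNac : N ⊆ Icc a c := fun u hu => (hbox b hbV u hu).2.1
  have hend : ∀ b' ∈ V, ∀ u ∈ N, u = 0 ∨ u = 1 → k (b', u) = 0 := by
    intro b' hb' u hu hu01
    obtain ⟨h1, -, h2, -⟩ := hbox b' hb' u hu
    have htar : (b', u) ∈ e.target := e.mem_target.2 h1
    have h3 : height φ (e.toOpenPartialHomeomorph.symm (b', u)) = 0 := by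
      rw [← F.mem_boundary_iff_height hφ h2,
        mem_boundary_iff_triv he (e.toOpenPartialHomeomorph.map_target htar),
        e.apply_symm_apply htar]
      exact hu01
    simp [hk, h3]
  have hGend : ∀ b' ∈ V, ∀ u ∈ N, u = 0 ∨ u = 1 → G (k (b', u)) = u := by
    intro b' hb' u hu hu01
    exact (congrArg G ((hend b' hb' u hu hu01).trans (hend b hbV u hu hu01).symm)).trans
      (hGl u (hNac hu))
  refine ⟨fun x => G (k x), a', c', hac', fun u hu => ?_, ?_⟩
  · filter_upwards [hN.mem_nhds (hac'N hu)] with u' hu' using hGl u' (hNac hu')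
  filter_upwards [hV.mem_nhds hbV] with b' hb'
  refine ⟨?_, fun h0 => hGend b' hb' 0 (hac'N h0) (Or.inl rfl),
    fun h1 => hGend b' hb' 1 (hac'N h1) (Or.inr rfl), fun u hu => ?_⟩
  · intro u hu v hv huv
    obtain ⟨-, hu1, -, hm, hu2, -⟩ := hbox b' hb' u (hac'N hu)
    obtain ⟨-, hv1, -, -, hv2, -⟩ := hbox b' hb' v (hac'N hv)
    exact hGm hu2 hv2 (hm hu1 hv1 huv)
  · obtain ⟨hb'e, hu1, huφ, hm, hu2, hkc⟩ := hbox b' hb' u (hac'N hu)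
    have hnear : ∀ᶠ y in 𝓝 (b', u), k y ∈ Icc (k (b, a)) (k (b, c)) := by
      filter_upwards [prod_mem_nhds (hV.mem_nhds hb') (hN.mem_nhds (hac'N hu))] with y hy
      exact (hVN hy).2.2.2.2.1
    refine ⟨?_, ?_, fun φ' hφ' hx => ?_⟩
    · exact (hGc _ hu2).tendsto.comp (tendsto_nhdsWithin_iff.2 ⟨hkc, hnear⟩)
    · obtain ⟨hG1, hG2⟩ := hGr _ hu2
      refine Quotient.sound (Relation.EqvGen.rel _ _ ⟨φ, hφ, huφ, hsrc _ hG1, ?_⟩)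
      rw [← height_eq_iff]
      apply mul_left_cancel₀ hσ
      rw [← hk, ← hk]
      exact hG2.symm
    · obtain ⟨γ, hγ⟩ := F.compatible φ' hφ' φ hφ _ ⟨hx, huφ⟩
      have hcs : ContinuousAt e.toOpenPartialHomeomorph.symm (b', u) :=
        e.toOpenPartialHomeomorph.symm.continuousAt (e.mem_target.2 hb'e)
      refine ⟨fun z => G (σ * (γ z).1 0), ?_⟩
      filter_upwards [hcs.eventually hγ] with y hy
      rw [hk, height, hy]

theorem hasTransport_zero {F : CodimOneFoliation m M} (hF : F.IsFoliatedIBundle pr)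
    {e : Trivialization (Icc (0 : ℝ) 1) pr} (he : IsSmoothTriv m e) {b : B} (hb : b ∈ e.baseSet) :
    HasTransport F e b 0 := by
  obtain ⟨T, a, c, hac, hT, hev⟩ := exists_local_transport hF he hb 0
  have h0 : (0 : Icc (0 : ℝ) 1) ∈ Icc a c := mem_of_mem_nhds hac
  have hle : ∀ u : Icc (0 : ℝ) 1, u ≤ 0 → u = 0 := fun u hu => le_antisymm hu u.2.1
  refine ⟨T, fun u hu => hle u hu ▸ hT 0 h0, hev.mono fun b' hb' => ⟨?_, hb'.2.1 h0,
    fun h => (zero_ne_one h).elim, fun u hu => hle u hu ▸ hb'.2.2.2 0 h0⟩⟩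
  intro u hu v hv huv
  rw [hle u hu, hle v hv] at huv
  exact (lt_irrefl _ huv).elim

/-- Gluing: a transport that is defined below `s` extends over a neighbourhood of `s`. -/
theorem exists_nhds_hasTransport_iff {F : CodimOneFoliation m M} (hF : F.IsFoliatedIBundle pr)
    {e : Trivialization (Icc (0 : ℝ) 1) pr} (he : IsSmoothTriv m e) {b : B} (hb : b ∈ e.baseSet)
    (r : Icc (0 : ℝ) 1) :
    ∃ N ∈ 𝓝 r, ∀ s ∈ N, ∀ t ∈ N, s ≤ t → HasTransport F e b s → HasTransport F e b t := by
  obtain ⟨T₂, a, c, hac, hT₂, hev₂⟩ := exists_local_transport hF he hb r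
  refine ⟨Icc a c, hac, fun s hs t ht hst ⟨T₁, hT₁, hev₁⟩ => ?_⟩
  have hsub : Icc s t ⊆ Icc a c := Icc_subset_Icc hs.1 ht.2
  have hagree : T₁ =ᶠ[𝓝 (b, s)] T₂ :=
    (hev₁.self_of_nhds.2.2.2 s le_rfl).eventuallyEq hF he hb (hev₂.self_of_nhds.2.2.2 s hs)
      (hT₁ s le_rfl) (hT₂ s hs)
  obtain ⟨V, N, hV, hbV, hN, hsN, hVN⟩ := mem_nhds_prod_iff'.1 hagree
  have hVN' : ∀ b' ∈ V, ∀ u ∈ N, T₁ (b', u) = T₂ (b', u) := fun b' hb' u hu =>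
    hVN (mk_mem_prod hb' hu)
  set T : B × Icc (0 : ℝ) 1 → Icc (0 : ℝ) 1 := fun x => if x.2 ≤ s then T₁ x else T₂ x with hT
  have hTle : ∀ b', ∀ u ≤ s, T (b', u) = T₁ (b', u) := fun b' u hu => if_pos hu
  have hTge : ∀ b' ∈ V, ∀ u, s ≤ u → T (b', u) = T₂ (b', u) := by
    intro b' hb' u hu
    rcases hu.eq_or_lt with rfl | hlt
    · rw [hTle b' _ le_rfl, hVN' b' hb' _ hsN]
    · exact if_neg hlt.not_ge
  -- near a point, the glued transport is one of the two given ones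
  have hnear₁ : ∀ b' ∈ V, ∀ u ≤ s, T =ᶠ[𝓝 (b', u)] T₁ := by
    intro b' hb' u hu
    rcases hu.eq_or_lt with rfl | hlt
    · filter_upwards [prod_mem_nhds (hV.mem_nhds hb') (hN.mem_nhds hsN)] with y hy
      rcases le_total y.2 u with h | h
      · exact hTle y.1 y.2 h
      · exact (hTge y.1 hy.1 y.2 h).trans (hVN' y.1 hy.1 y.2 hy.2).symm
    · filter_upwards [(continuous_snd.tendsto (b', u)).eventually_mem (Iio_mem_nhds hlt)] with y hy
      exact hTle y.1 y.2 (le_of_lt hy)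
  have hnear₂ : ∀ b' ∈ V, ∀ u, s < u → T =ᶠ[𝓝 (b', u)] T₂ := by
    intro b' hb' u hlt
    filter_upwards [(continuous_snd.tendsto (b', u)).eventually_mem (Ioi_mem_nhds hlt)] with y hy
    exact if_neg (not_le.2 hy)
  have hfib : ∀ u : Icc (0 : ℝ) 1, Tendsto (fun u' => (b, u')) (𝓝 u) (𝓝 (b, u)) := fun u =>
    Continuous.tendsto (by fun_prop) u
  refine ⟨T, fun u hu => ?_, ?_⟩
  · rcases le_or_gt u s with h | h
    · filter_upwards [hT₁ u h, (hfib u).eventually (hnear₁ b hbV u h)] with u' h1 h2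
      exact h2.trans h1
    · filter_upwards [hT₂ u (hsub ⟨h.le, hu⟩), (hfib u).eventually (hnear₂ b hbV u h)] with u' h1 h2
      exact h2.trans h1
  filter_upwards [hev₁, hev₂, hV.mem_nhds hbV] with b' h1 h2 hb'
  refine ⟨?_, (hTle b' 0 s.2.1).trans h1.2.1, ?_, fun u hu => ?_⟩
  · rw [← Iic_union_Icc_eq_Iic hst]
    refine StrictMonoOn.union (c := s) ?_ ?_ isGreatest_Iic (isLeast_Icc hst)
    · exact h1.1.congr fun u hu => (hTle b' u hu).symm
    · exact (h2.1.mono hsub).congr fun u hu => (hTge b' hb' u hu.1).symm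
  · rintro rfl
    exact (hTge b' hb' 1 s.2.2).trans (h2.2.2.1 ht)
  · rcases le_or_gt u s with h | h
    · exact (h1.2.2.2 u h).congr (hnear₁ b' hb' u h)
    · exact (h2.2.2.2 u (hsub ⟨h.le, hu⟩)).congr (hnear₂ b' hb' u h)

theorem hasTransport_one {F : CodimOneFoliation m M} (hF : F.IsFoliatedIBundle pr)
    {e : Trivialization (Icc (0 : ℝ) 1) pr} (he : IsSmoothTriv m e) {b : B} (hb : b ∈ e.baseSet) :
    HasTransport F e b 1 := by
  have hloc : IsLocallyConstant (HasTransport F e b) := by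
    rw [IsLocallyConstant.iff_eventually_eq]
    intro r
    obtain ⟨N, hN, hN'⟩ := exists_nhds_hasTransport_iff hF he hb r
    filter_upwards [hN] with s hs
    have hr : r ∈ N := mem_of_mem_nhds hN
    rcases le_total s r with h | h
    · exact propext ⟨hN' s hs r hr h, HasTransport.mono h⟩
    · exact propext ⟨HasTransport.mono h, hN' r hr s hs h⟩
  exact (hloc.apply_eq_of_preconnectedSpace 0 1).mp (hasTransport_zero hF he hb)

/-- A flat chart over the open set `V` of the base: a function `T` on `pr ⁻¹' V` whose restriction
to every fibre over `V` is a homeomorphism onto `[0, 1]`, whose level sets lie in leaves, and which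
is locally a function of the transverse coordinate of the foliated charts. -/
structure IsFlatChart (F : CodimOneFoliation m M) (pr : M → B) (V : Set B)
    (T : M → Icc (0 : ℝ) 1) : Prop where
  isOpen : IsOpen V
  continuousAt : ∀ p, pr p ∈ V → ContinuousAt T p
  leafOf_eq : ∀ p q, pr p ∈ V → pr q ∈ V → T p = T q → F.leafOf p = F.leafOf q
  factors : ∀ p, pr p ∈ V → ∀ φ ∈ F.charts, p ∈ φ.source →
    ∃ γ : EuclideanHalfSpace 1 → Icc (0 : ℝ) 1, ∀ᶠ q in 𝓝 p, T q = γ (φ q).2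
  fibre : ∀ b ∈ V, ∃ σ : Icc (0 : ℝ) 1 → M, Continuous σ ∧ (∀ u, pr (σ u) = b ∧ T (σ u) = u) ∧
    ∀ p, pr p = b → σ (T p) = p

theorem exists_isFlatChart {F : CodimOneFoliation m M} (hF : F.IsFoliatedIBundle pr) (b : B) :
    ∃ (V : Set B) (T : M → Icc (0 : ℝ) 1), b ∈ V ∧ IsFlatChart F pr V T := by
  obtain ⟨e, hb, hes, hes'⟩ := hF.locally_trivial b
  have he : IsSmoothTriv m e := ⟨hes, hes'⟩
  obtain ⟨T, -, hev⟩ := hasTransport_one hF he hb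
  obtain ⟨V, hVev, hV, hbV⟩ := eventually_nhds_iff.1 (hev.and (e.open_baseSet.mem_nhds hb))
  have hsrc : ∀ p, pr p ∈ V → p ∈ e.source := fun p hp => e.mem_source.2 (hVev _ hp).2
  have hsymm : ∀ p, pr p ∈ V → e.toOpenPartialHomeomorph.symm (e p) = p := fun p hp =>
    e.toOpenPartialHomeomorph.left_inv (hsrc p hp)
  have hpr : ∀ p, pr p ∈ V → e p = (pr p, (e p).2) := fun p hp =>
    Prod.ext (e.coe_fst (hsrc p hp)) rfl
  have hgerm : ∀ p, pr p ∈ V → IsTransportAt F e b T (e p) := fun p hp => by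
    rw [hpr p hp]
    exact (hVev _ hp).1.2.2.2 _ (e p).2.2.2
  have hec : ∀ p, pr p ∈ V → ContinuousAt e p := fun p hp =>
    e.toOpenPartialHomeomorph.continuousAt (hsrc p hp)
  refine ⟨V, fun p => T (e p), hbV, hV, fun p hp => ?_, fun p q hp hq h => ?_,
    fun p hp φ hφ hpφ => ?_, fun b' hb' => ?_⟩
  · exact (hgerm p hp).continuousAt.comp (hec p hp)
  · have h1 := (hgerm p hp).leafOf_eq
    have h2 := (hgerm q hq).leafOf_eq
    rw [hsymm p hp] at h1
    rw [hsymm q hq] at h2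
    rw [h1, h2, h]
  · obtain ⟨γ, hγ⟩ := (hgerm p hp).factors φ hφ (by rwa [hsymm p hp])
    refine ⟨γ, ?_⟩
    filter_upwards [(hec p hp).eventually hγ, e.open_source.mem_nhds (hsrc p hp)] with q hq hq'
    rw [hq]
    exact congrArg (fun z => γ (φ z).2) (e.toOpenPartialHomeomorph.left_inv hq')
  · obtain ⟨⟨hmono, h0, h1, hg⟩, hb'e⟩ := hVev b' hb'
    have htar : ∀ u, (b', u) ∈ e.target := fun u => e.mem_target.2 hb'e
    have hm : StrictMono fun u => T (b', u) := fun u v huv => hmono u.2.2 v.2.2 huv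
    have hc : Continuous fun u => T (b', u) := continuous_iff_continuousAt.2 fun u =>
      (hg u u.2.2).continuousAt.comp (f := fun u => (b', u)) (by fun_prop)
    have hsurj : Function.Surjective fun u => T (b', u) := fun r => by
      obtain ⟨u, -, hu⟩ := intermediate_value_Icc (zero_le_one (α := Icc (0 : ℝ) 1)) hc.continuousOn
        (show r ∈ Icc (T (b', 0)) (T (b', 1)) by rw [h0, h1 rfl]; exact ⟨r.2.1, r.2.2⟩)
      exact ⟨u, hu⟩
    set Φ := hm.orderIsoOfSurjective _ hsurj with hΦ
    have hΦT : ∀ u, T (b', Φ.symm u) = u := fun u => Φ.apply_symm_apply u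
    refine ⟨fun u => e.toOpenPartialHomeomorph.symm (b', Φ.symm u), ?_, fun u => ⟨?_, ?_⟩,
      fun p hp => ?_⟩
    · rw [← continuousOn_univ]
      exact e.toOpenPartialHomeomorph.continuousOn_symm.comp
        (f := fun u => (b', Φ.symm u)) (continuous_const.prodMk Φ.symm.continuous).continuousOn
        fun u _ => htar _
    · exact e.proj_symm_apply (htar _)
    · rw [e.apply_symm_apply (htar _), hΦT]
    · subst hp
      change e.toOpenPartialHomeomorph.symm (pr p, Φ.symm (T (e p))) = p
      have h2 : Φ.symm (T (e p)) = (e p).2 := by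
        rw [hpr p hb']
        exact Φ.symm_apply_apply (e p).2
      rw [h2, ← hpr p hb', hsymm p hb']

end CodimOneFoliation

/-! ### Separation of leaves -/

namespace CodimOneFoliation

section Boundary

variable {m : ℕ} {M : Type*} [TopologicalSpace M] [ChartedSpace (HalfBox m) M]

/-- A property that is invariant in plaques is invariant in leaves. -/
theorem iff_of_leafOf_eq {F : CodimOneFoliation m M} {P : M → Prop}
    (hP : ∀ p q, F.SamePlaque p q → (P p ↔ P q)) {p q : M} (h : F.leafOf p = F.leafOf q) :
    P p ↔ P q := by
  have h1 : Relation.EqvGen F.SamePlaque p q := Quotient.exact h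
  induction h1 with
  | rel p q hpq => exact hP p q hpq
  | refl p => exact Iff.rfl
  | symm p q _ ih => exact (ih (Eq.symm h)).symm
  | trans p q r hpq _ ih ih' =>
    have h2 : F.leafOf p = F.leafOf q := Quotient.sound hpq
    exact (ih h2).trans (ih' (h2.symm.trans h))

theorem exists_isBoundaryLeaf {B : Type*} [TopologicalSpace B]
    [ChartedSpace (EuclideanSpace ℝ (Fin m)) B] [IsManifold (halfBoxModel m) ∞ M] [Nonempty M]
    {F : CodimOneFoliation m M} {pr : M → B} (hF : F.IsFoliatedIBundle pr) :
    ∃ L₀ : F.LeafSpace, F.IsBoundaryLeaf L₀ := by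
  obtain ⟨p⟩ := ‹Nonempty M›
  obtain ⟨e, hb, hes, hes'⟩ := hF.locally_trivial (pr p)
  have htar : (pr p, (0 : Icc (0 : ℝ) 1)) ∈ e.target := e.mem_target.2 hb
  have hq : e.toOpenPartialHomeomorph.symm (pr p, 0) ∈ (halfBoxModel m).boundary M := by
    rw [mem_boundary_iff_triv ⟨hes, hes'⟩ (e.toOpenPartialHomeomorph.map_target htar),
      e.apply_symm_apply htar]
    exact Or.inl rfl
  refine ⟨F.leafOf (e.toOpenPartialHomeomorph.symm (pr p, 0)), fun q hq' => ?_⟩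
  refine (iff_of_leafOf_eq (F := F) (P := fun q => q ∈ (halfBoxModel m).boundary M) ?_ hq').2 hq
  rintro x y ⟨φ, hφ, hx, hy, hxy⟩
  rw [F.mem_boundary_iff_height hφ hx, F.mem_boundary_iff_height hφ hy, height_eq_iff.2 hxy]

end Boundary

section Joined

variable {m : ℕ} {B M : Type*} [TopologicalSpace M] [ChartedSpace (HalfBox m) M]

/-- The point `p` and some point of the leaf `A` on the fibre through `p` are joined by a segment
of this fibre that does not meet the leaf `L`. -/
def IsJoined (F : CodimOneFoliation m M) (pr : M → B) (A L : F.LeafSpace) (p : M) : Prop :=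
  ∃ q, F.leafOf q = A ∧ ∃ S : Set M, IsPreconnected S ∧ q ∈ S ∧ p ∈ S ∧
    ∀ z ∈ S, pr z = pr p ∧ F.leafOf z ≠ L

theorem isJoined_self {F : CodimOneFoliation m M} (pr : M → B) {L : F.LeafSpace} {p : M}
    (hp : F.leafOf p ≠ L) : F.IsJoined pr (F.leafOf p) L p :=
  ⟨p, rfl, {p}, isPreconnected_singleton, rfl, rfl, by rintro z rfl; exact ⟨rfl, hp⟩⟩

/-- The same segment, seen from its other end. -/
theorem IsJoined.symm {F : CodimOneFoliation m M} {pr : M → B} {A L : F.LeafSpace} {p : M}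
    (h : F.IsJoined pr A L p) :
    ∃ q, F.leafOf q = A ∧ F.IsJoined pr (F.leafOf p) L q := by
  obtain ⟨q, hq, S, hSc, hqS, hpS, hS⟩ := h
  exact ⟨q, hq, p, rfl, S, hSc, hpS, hqS,
    fun z hz => ⟨(hS z hz).1.trans (hS q hqS).1.symm, (hS z hz).2⟩⟩

variable [TopologicalSpace B]

/-- In a flat chart, whether `p` and `A` are joined off `L` can be read off from the heights. -/
theorem IsFlatChart.isJoined_iff {F : CodimOneFoliation m M} {pr : M → B} {V : Set B}
    {T : M → Icc (0 : ℝ) 1} (h : IsFlatChart F pr V T) {A L : F.LeafSpace} {p : M} (hp : pr p ∈ V) :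
    F.IsJoined pr A L p ↔ ∃ q, pr q ∈ V ∧ F.leafOf q = A ∧
      ∀ z, pr z ∈ V → T z ∈ uIcc (T q) (T p) → F.leafOf z ≠ L := by
  constructor
  · rintro ⟨q, hq, S, hSc, hqS, hpS, hS⟩
    have hqV : pr q ∈ V := (hS q hqS).1 ▸ hp
    have hTS : (T '' S).OrdConnected := by
      refine (hSc.image T fun z hz => ?_).ordConnected
      exact (h.continuousAt z ((hS z hz).1 ▸ hp)).continuousWithinAt
    refine ⟨q, hqV, hq, fun z hz hzT => ?_⟩
    obtain ⟨w, hw, hwz⟩ := hTS.uIcc_subset (mem_image_of_mem T hqS) (mem_image_of_mem T hpS) hzT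
    rw [← h.leafOf_eq w z ((hS w hw).1 ▸ hp) hz hwz]
    exact (hS w hw).2
  · rintro ⟨q, hqV, hq, hL⟩
    obtain ⟨σ, hσc, hσ, hσp⟩ := h.fibre _ hp
    have hσV : ∀ u, pr (σ u) ∈ V := fun u => (hσ u).1 ▸ hp
    refine ⟨σ (T q), ?_, σ '' uIcc (T q) (T p), isPreconnected_uIcc.image _ hσc.continuousOn,
      mem_image_of_mem _ left_mem_uIcc, ⟨T p, right_mem_uIcc, hσp p rfl⟩, ?_⟩
    · rw [← hq]
      exact h.leafOf_eq _ _ (hσV _) hqV (hσ _).2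
    · rintro _ ⟨u, hu, rfl⟩
      exact ⟨(hσ u).1, hL _ (hσV u) (by rwa [(hσ u).2])⟩

variable [ChartedSpace (EuclideanSpace ℝ (Fin m)) B]

theorem IsFoliatedIBundle.continuous {F : CodimOneFoliation m M} {pr : M → B}
    (hF : F.IsFoliatedIBundle pr) : Continuous pr :=
  continuous_iff_continuousAt.2 fun p => by
    obtain ⟨e, hb, -⟩ := hF.locally_trivial (pr p)
    exact e.continuousAt_proj (e.mem_source.2 hb)

variable [IsManifold (halfBoxModel m) ∞ M]

theorem isJoined_iff_of_leafOf_eq {F : CodimOneFoliation m M} {pr : M → B}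
    (hF : F.IsFoliatedIBundle pr) {A L : F.LeafSpace} {p q : M} (hpq : F.leafOf p = F.leafOf q) :
    F.IsJoined pr A L p ↔ F.IsJoined pr A L q := by
  refine iff_of_leafOf_eq (F := F) ?_ hpq
  rintro x y ⟨φ, hφ, hx, hy, hxy⟩
  refine (F.plaque_connected φ hφ (φ x).2).induction₂
    (fun p q => F.IsJoined pr A L p ↔ F.IsJoined pr A L q) ?_ (fun _ _ _ _ _ _ h h' => h.trans h')
    (fun _ _ _ _ h => h.symm) ⟨hx, rfl⟩ ⟨hy, hxy.symm⟩
  rintro p ⟨hp, hpx⟩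
  obtain ⟨V, T, hpV, hT⟩ := exists_isFlatChart hF (pr p)
  obtain ⟨γ, hγ⟩ := hT.factors p hpV φ hφ hp
  have hev : ∀ᶠ q in 𝓝 p, pr q ∈ V :=
    hF.continuous.continuousAt.eventually_mem (hT.isOpen.mem_nhds hpV)
  filter_upwards [nhdsWithin_le_nhds hγ, nhdsWithin_le_nhds hev, self_mem_nhdsWithin]
    with q hq hqV hqP
  have hTq : T q = T p := by rw [hq, hγ.self_of_nhds, hqP.2, hpx]
  rw [hT.isJoined_iff hpV, hT.isJoined_iff hqV, hTq]

/-- Along a path that does not meet the leaf `L`, being joined to `A` off `L` does not change: the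
height of the path in a flat chart moves continuously and cannot jump over a plaque of `L`. -/
theorem isLocallyConstant_isJoined {F : CodimOneFoliation m M} {pr : M → B}
    (hF : F.IsFoliatedIBundle pr) {A L : F.LeafSpace} {c : Icc (0 : ℝ) 1 → M} (hc : Continuous c)
    (hL : ∀ t, F.leafOf (c t) ≠ L) : IsLocallyConstant fun t => F.IsJoined pr A L (c t) := by
  rw [IsLocallyConstant.iff_eventually_eq]
  intro t₀
  obtain ⟨V, T, hV, hT⟩ := exists_isFlatChart hF (pr (c t₀))
  have hev : ∀ᶠ t in 𝓝 t₀, pr (c t) ∈ V :=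
    (hF.continuous.comp hc).continuousAt.eventually_mem (hT.isOpen.mem_nhds hV)
  obtain ⟨a, b, -, hab, habV⟩ := exists_Icc_mem_subset_of_mem_nhds hev
  have hmove : ∀ s ∈ Icc a b, ∀ t ∈ Icc a b,
      F.IsJoined pr A L (c s) → F.IsJoined pr A L (c t) := by
    intro s hs t ht
    rw [hT.isJoined_iff (habV hs), hT.isJoined_iff (habV ht)]
    rintro ⟨q, hqV, hqA, hq⟩
    refine ⟨q, hqV, hqA, fun z hz hzT => ?_⟩
    rcases uIcc_subset_uIcc_union_uIcc (b := T (c s)) hzT with h | h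
    · exact hq z hz h
    · have hsub : uIcc s t ⊆ Icc a b := ordConnected_Icc.uIcc_subset hs ht
      have hcont : ContinuousOn (fun t => T (c t)) (uIcc s t) := fun w hw =>
        ((hT.continuousAt _ (habV (hsub hw))).comp hc.continuousAt).continuousWithinAt
      obtain ⟨w, hw, hwz⟩ := intermediate_value_uIcc hcont h
      rw [← hT.leafOf_eq _ _ (habV (hsub hw)) hz hwz]
      exact hL w
  filter_upwards [hab] with t ht
  have ht₀ : t₀ ∈ Icc a b := mem_of_mem_nhds hab
  exact propext ⟨hmove t ht t₀ ht₀, hmove t₀ ht₀ t ht⟩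

/-- Of two leaves, one separates the other from a given boundary leaf `L₀`: on a fibre through a
point of `L₀`, which is an end of this fibre, the points of `L` and `L'` are linearly ordered. -/
theorem not_isJoined_of_isJoined {F : CodimOneFoliation m M} {pr : M → B}
    (hF : F.IsFoliatedIBundle pr) {L₀ : F.LeafSpace} (hL₀ : F.IsBoundaryLeaf L₀) {p q : M}
    (hp : F.IsJoined pr L₀ (F.leafOf q) p) : ¬ F.IsJoined pr L₀ (F.leafOf p) q := by
  intro hq
  obtain ⟨x, hx, hxp⟩ := hp.symm
  obtain ⟨y, hy, hyq⟩ := hq.symm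
  -- move the second segment along `L₀` to the fibre through `x`
  rw [isJoined_iff_of_leafOf_eq hF (hy.trans hx.symm)] at hyq
  obtain ⟨p', hp', S, hSc, hpS, hxS, hS⟩ := hxp
  obtain ⟨q', hq', S', hSc', hqS, hxS', hS'⟩ := hyq
  obtain ⟨e, hb, hes, hes'⟩ := hF.locally_trivial (pr x)
  have hsrc : ∀ z, pr z = pr x → z ∈ e.source := fun z hz => e.mem_source.2 (hz ▸ hb)
  have hinj : ∀ z w, pr z = pr x → pr w = pr x → (e z).2 = (e w).2 → z = w := fun z w hz hw h =>
    e.injOn (hsrc z hz) (hsrc w hw)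
      (Prod.ext ((e.coe_fst (hsrc z hz)).trans
        ((hz.trans hw.symm).trans (e.coe_fst (hsrc w hw)).symm)) h)
  have hord : ∀ R : Set M, IsPreconnected R → (∀ z ∈ R, pr z = pr x) →
      ((fun z => (e z).2) '' R).OrdConnected := fun R hR hRx =>
    (hR.image _ fun z hz => (continuous_snd.continuousAt.comp
      (e.toOpenPartialHomeomorph.continuousAt (hsrc z (hRx z hz)))).continuousWithinAt).ordConnected
  have hO := hord S hSc fun z hz => (hS z hz).1
  have hO' := hord S' hSc' fun z hz => (hS' z hz).1
  -- the point of `{p', q'}` that is nearer to the end `x` lies on the segment to the other point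
  have key : (e q').2 ∈ uIcc (e x).2 (e p').2 ∨ (e p').2 ∈ uIcc (e x).2 (e q').2 := by
    have hxb := (mem_boundary_iff_triv ⟨hes, hes'⟩ (hsrc x rfl)).1 (hL₀ hx)
    rcases hxb with h | h <;> rcases le_total (e p').2 (e q').2 with h' | h'
    · exact Or.inr (mem_uIcc.2 (Or.inl ⟨h ▸ (e p').2.2.1, h'⟩))
    · exact Or.inl (mem_uIcc.2 (Or.inl ⟨h ▸ (e q').2.2.1, h'⟩))
    · exact Or.inl (mem_uIcc.2 (Or.inr ⟨h', h ▸ (e q').2.2.2⟩))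
    · exact Or.inr (mem_uIcc.2 (Or.inr ⟨h', h ▸ (e p').2.2.2⟩))
  rcases key with h | h
  · obtain ⟨w, hw, hwq⟩ := hO.uIcc_subset (mem_image_of_mem _ hxS) (mem_image_of_mem _ hpS) h
    have : w = q' := hinj w q' (hS w hw).1 (hS' q' hqS).1 hwq
    exact (hS w hw).2 (this ▸ hq')
  · obtain ⟨w, hw, hwp⟩ := hO'.uIcc_subset (mem_image_of_mem _ hxS') (mem_image_of_mem _ hqS) h
    have : w = p' := hinj w p' (hS' w hw).1 (hS p' hpS).1 hwp
    exact (hS' w hw).2 (this ▸ hp')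

end Joined

end CodimOneFoliation

/-! ### The metric on the leaf space -/

/-- A path from `x` to `y` of length less than `r`: at each of its points it splits into two paths
of total length less than `r`. -/
theorem exists_path_dist_add_dist_le {E H : Type*} [NormedAddCommGroup E]
    [NormedSpace ℝ E] [TopologicalSpace H] (I : ModelWithCorners ℝ E H) {M : Type*} [MetricSpace M]
    [ChartedSpace H M] [RiemannianBundle (fun x : M => TangentSpace I x)]
    [IsRiemannianManifold I M] (x y : M) {r : ℝ} (hr : dist x y < r) :
    ∃ c : Icc (0 : ℝ) 1 → M, Continuous c ∧ c 0 = x ∧ c 1 = y ∧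
      ∀ t, dist x (c t) + dist (c t) y ≤ r := by
  have h0 : 0 ≤ r := dist_nonneg.trans hr.le
  have h1 : Manifold.riemannianEDist I x y < ENNReal.ofReal r := by
    rw [← IsRiemannianManifold.out (I := I) x y, edist_dist]
    exact (ENNReal.ofReal_lt_ofReal_iff_of_nonneg dist_nonneg).2 hr
  obtain ⟨γ, hγ0, hγ1, hγ, hlen⟩ := Manifold.exists_lt_of_riemannianEDist_lt h1
  refine ⟨fun t => γ t, continuousOn_iff_continuous_domRestrict.1 hγ.continuousOn, hγ0, hγ1,
    fun t => ?_⟩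
  have hx := Manifold.riemannianEDist_le_pathELength (I := I)
    (hγ.mono (Icc_subset_Icc_right t.2.2)) hγ0 rfl t.2.1
  have hy := Manifold.riemannianEDist_le_pathELength (I := I)
    (hγ.mono (Icc_subset_Icc_left t.2.1)) rfl hγ1 t.2.2
  have hadd := (add_le_add hx hy).trans
    ((pathELength_add t.2.1 t.2.2).le.trans hlen.le)
  rw [← IsRiemannianManifold.out (I := I), ← IsRiemannianManifold.out
    (I := I), edist_dist, edist_dist, ← ENNReal.ofReal_add dist_nonneg dist_nonneg]
    at hadd
  exact (ENNReal.ofReal_le_ofReal_iff h0).1 hadd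

namespace CodimOneFoliation

section LeafMetric

variable {m : ℕ} {M : Type*} [MetricSpace M] [ChartedSpace (HalfBox m) M]

theorem IsChainLength.rho_le {F : CodimOneFoliation m M} {L L' : F.LeafSpace} {s : ℝ}
    (h : F.IsChainLength L L' s) : F.rho L L' ≤ s :=
  csInf_le (F.bddBelow_isChainLength L L') h

theorem rho_le_leafDist (F : CodimOneFoliation m M) (L L' : F.LeafSpace) :
    F.rho L L' ≤ F.leafDist L L' :=
  IsChainLength.rho_le ⟨1, fun i => if i = 0 then L else L', by simp, by simp, by simp⟩

theorem rho_leafOf_le_dist (F : CodimOneFoliation m M) (p q : M) :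
    F.rho (F.leafOf p) (F.leafOf q) ≤ dist p q :=
  (F.rho_le_leafDist _ _).trans <|
    ciInf_le (f := fun x : F.carrier (F.leafOf p) × F.carrier (F.leafOf q) => dist (x.1 : M) x.2)
      ⟨0, by rintro _ ⟨x, rfl⟩; exact dist_nonneg⟩ (⟨p, rfl⟩, ⟨q, rfl⟩)

theorem dist_toHLS (F : CodimOneFoliation m M) (L L' : F.LeafSpace) :
    dist (F.toHLS L) (F.toHLS L') = F.rho L L' :=
  SeparationQuotient.dist_mk L L'

theorem continuous_toHLS_leafOf (F : CodimOneFoliation m M) :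
    Continuous fun p => F.toHLS (F.leafOf p) := by
  refine (LipschitzWith.of_dist_le_mul (K := 1) fun p q => ?_).continuous
  rw [dist_toHLS, NNReal.coe_one, one_mul]
  exact F.rho_leafOf_le_dist p q

theorem surjective_toHLS_leafOf (F : CodimOneFoliation m M) :
    Function.Surjective fun p => F.toHLS (F.leafOf p) := by
  rintro ⟨⟨p⟩⟩
  exact ⟨p, rfl⟩

end LeafMetric

section Riemannian

variable {m : ℕ} {B M : Type*} [TopologicalSpace B] [ChartedSpace (EuclideanSpace ℝ (Fin m)) B]
  [MetricSpace M] [ChartedSpace (HalfBox m) M] [IsManifold (halfBoxModel m) ∞ M]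
  [RiemannianBundle (fun x : M => TangentSpace (halfBoxModel m) x)]
  [IsRiemannianManifold (halfBoxModel m) M]

/-- If `x` is joined to `A` off `L` and `y` is not, then the short paths from `x` to `y` cross
`L`. -/
theorem rho_add_rho_le_dist {F : CodimOneFoliation m M} {pr : M → B}
    (hF : F.IsFoliatedIBundle pr) {A L : F.LeafSpace} {x y : M} (hx : F.IsJoined pr A L x)
    (hy : ¬ F.IsJoined pr A L y) :
    F.rho (F.leafOf x) L + F.rho L (F.leafOf y) ≤ dist x y := by
  refine le_of_forall_gt_imp_ge_of_dense fun r hr => ?_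
  obtain ⟨c, hc, hc0, hc1, hcr⟩ := exists_path_dist_add_dist_le (halfBoxModel m) x y hr
  have hcross : ∃ t, F.leafOf (c t) = L := by
    by_contra! hL
    have h := (isLocallyConstant_isJoined hF (A := A) hc hL).apply_eq_of_preconnectedSpace 0 1
    rw [hc0, hc1] at h
    exact hy (h.mp hx)
  obtain ⟨t, rfl⟩ := hcross
  exact (add_le_add (F.rho_leafOf_le_dist _ _) (F.rho_leafOf_le_dist _ _)).trans (hcr t)

/-- If the first leaf of a chain is joined to `A` off `L` and the last one is not, then there is a
step of the chain between two such leaves, and inserting `L` there does not make the chain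
longer. -/
theorem rho_add_rho_le_of_isChainLength {F : CodimOneFoliation m M} {pr : M → B}
    (hF : F.IsFoliatedIBundle pr) {A L : F.LeafSpace} {p q : M} (hp : F.IsJoined pr A L p)
    (hq : ¬ F.IsJoined pr A L q) {s : ℝ} (hs : F.IsChainLength (F.leafOf p) (F.leafOf q) s) :
    F.rho (F.leafOf p) L + F.rho L (F.leafOf q) ≤ s := by
  obtain ⟨n, c, h0, hn, rfl⟩ := hs
  induction n generalizing p c with
  | zero => exact (hq ((isJoined_iff_of_leafOf_eq hF (h0.symm.trans hn)).1 hp)).elim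
  | succ n ih =>
    rw [Finset.sum_range_succ', add_comm]
    obtain ⟨p₁, hp₁⟩ := F.carrier_nonempty (c 1)
    have hp₁ : F.leafOf p₁ = c 1 := hp₁
    by_cases hJ : F.IsJoined pr A L p₁
    · have h1 := ih hJ (fun i => c (i + 1)) hp₁.symm hn
      have h2 := F.rho_le_leafDist (c 0) (c 1)
      have h3 := F.rho_triangle (c 0) (c 1) L
      rw [hp₁] at h1
      rw [← h0]
      linarith
    · have h1 : F.rho (c 0) L + F.rho L (c 1) ≤ F.leafDist (c 0) (c 1) := by
        have := (F.carrier_nonempty (c 0)).to_subtype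
        have := (F.carrier_nonempty (c 1)).to_subtype
        refine le_ciInf fun z => ?_
        have hx : F.leafOf z.1 = c 0 := z.1.2
        have hy : F.leafOf z.2 = c 1 := z.2.2
        have h2 := rho_add_rho_le_dist hF (A := A) (L := L) (x := z.1) (y := z.2)
          ((isJoined_iff_of_leafOf_eq hF (hx.trans h0)).2 hp)
          (by rwa [isJoined_iff_of_leafOf_eq hF (hy.trans hp₁.symm)])
        rwa [hx, hy] at h2
      have h2 := F.rho_triangle L (c 1) (F.leafOf q)
      have h3 : F.rho (c 1) (F.leafOf q) ≤ _ :=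
        IsChainLength.rho_le ⟨n, fun i => c (i + 1), rfl, hn, rfl⟩
      rw [← h0]
      linarith

theorem rho_add_rho_le_rho {F : CodimOneFoliation m M} {pr : M → B}
    (hF : F.IsFoliatedIBundle pr) {L : F.LeafSpace} {p q : M} (hp : F.leafOf p ≠ L)
    (hq : ¬ F.IsJoined pr (F.leafOf p) L q) :
    F.rho (F.leafOf p) L + F.rho L (F.leafOf q) ≤ F.rho (F.leafOf p) (F.leafOf q) :=
  le_csInf (F.isChainLength_nonempty _ _) fun _ hs =>
    rho_add_rho_le_of_isChainLength hF (isJoined_self pr hp) hq hs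

/-- One of the leaves `L`, `L'` separates the other from `L₀`, which gives equality in one of the
triangle inequalities for `L₀`, `L`, `L'`. -/
theorem rho_eq_abs_sub {F : CodimOneFoliation m M} {pr : M → B}
    (hF : F.IsFoliatedIBundle pr) {L₀ : F.LeafSpace} (hL₀ : F.IsBoundaryLeaf L₀)
    (L L' : F.LeafSpace) : F.rho L L' = |F.rho L₀ L - F.rho L₀ L'| := by
  obtain ⟨p₀, rfl⟩ := F.carrier_nonempty L₀
  obtain ⟨p, rfl⟩ := F.carrier_nonempty L
  obtain ⟨p', rfl⟩ := F.carrier_nonempty L'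
  apply le_antisymm
  · rw [le_abs]
    by_cases h1 : F.leafOf p₀ = F.leafOf p
    · right; rw [h1, F.rho_self]; linarith
    by_cases h2 : F.leafOf p₀ = F.leafOf p'
    · left; rw [h2, F.rho_self, F.rho_comm]; linarith
    by_cases h3 : F.IsJoined pr (F.leafOf p₀) (F.leafOf p) p'
    · left
      have h4 := rho_add_rho_le_rho hF h2 (not_isJoined_of_isJoined hF hL₀ h3)
      rw [F.rho_comm (F.leafOf p') (F.leafOf p)] at h4
      linarith
    · right
      have h4 := rho_add_rho_le_rho hF h1 h3
      linarith
  · have h1 := F.rho_triangle (F.leafOf p₀) (F.leafOf p) (F.leafOf p')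
    have h2 := F.rho_triangle (F.leafOf p₀) (F.leafOf p') (F.leafOf p)
    rw [F.rho_comm (F.leafOf p') (F.leafOf p)] at h2
    rw [abs_le]
    constructor <;> linarith

end Riemannian

end CodimOneFoliation

theorem mainTheorem7 {m : ℕ} {B M : Type*}
    [TopologicalSpace B] [T2Space B] [ChartedSpace (EuclideanSpace ℝ (Fin m)) B]
    [IsManifold (𝓡 m) ∞ B]
    [MetricSpace M] [CompactSpace M] [ConnectedSpace M]
    [ChartedSpace (HalfBox m) M] [IsManifold (halfBoxModel m) ∞ M]
    [RiemannianBundle (fun x : M => TangentSpace (halfBoxModel m) x)]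
    [IsContMDiffRiemannianBundle (halfBoxModel m) ∞
      (EuclideanSpace ℝ (Fin m) × EuclideanSpace ℝ (Fin 1))
      (fun x : M => TangentSpace (halfBoxModel m) x)]
    [IsRiemannianManifold (halfBoxModel m) M]
    (F : CodimOneFoliation m M) (pr : M → B) (hF : F.IsFoliatedIBundle pr) :
    (∃ L₀ : F.LeafSpace, F.IsBoundaryLeaf L₀) ∧
    ∀ L₀ : F.LeafSpace, F.IsBoundaryLeaf L₀ →
      ∃ δ : ℝ, IsGreatest (range fun L : F.LeafSpace => dist (F.toHLS L₀) (F.toHLS L)) δ ∧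
        Nonempty (F.HausdorffLeafSpace ≃ᵢ Icc (0 : ℝ) δ) := by
  refine ⟨CodimOneFoliation.exists_isBoundaryLeaf hF, fun L₀ hL₀ => ?_⟩
  set h : F.HausdorffLeafSpace → ℝ := fun ξ => dist (F.toHLS L₀) ξ with hh
  have hsurj := F.surjective_toHLS_leafOf
  have hcont : Continuous fun p => h (F.toHLS (F.leafOf p)) :=
    continuous_const.dist F.continuous_toHLS_leafOf
  have hiso : ∀ ξ η, dist (h ξ) (h η) = dist ξ η := by
    intro ξ η
    obtain ⟨p, rfl⟩ := hsurj ξ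
    obtain ⟨q, rfl⟩ := hsurj η
    simp only [hh, F.dist_toHLS, Real.dist_eq]
    exact (CodimOneFoliation.rho_eq_abs_sub hF hL₀ _ _).symm
  obtain ⟨p, -, hp⟩ := isCompact_univ.exists_isMaxOn univ_nonempty hcont.continuousOn
  have hmax : ∀ ξ, h ξ ≤ h (F.toHLS (F.leafOf p)) := fun ξ => by
    obtain ⟨q, rfl⟩ := hsurj ξ
    exact hp (mem_univ q)
  refine ⟨h (F.toHLS (F.leafOf p)), ⟨⟨F.leafOf p, rfl⟩, ?_⟩, ⟨?_⟩⟩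
  · rintro _ ⟨L, rfl⟩
    exact hmax (F.toHLS L)
  refine IsometryEquiv.mk (Equiv.ofBijective (fun ξ => ⟨h ξ, dist_nonneg, hmax ξ⟩) ⟨?_, ?_⟩) ?_
  · intro ξ η hξη
    rw [← dist_eq_zero, ← hiso, Subtype.mk.inj hξη, dist_self]
  · rintro ⟨r, hr⟩
    obtain ⟨p₀, hp₀⟩ := F.carrier_nonempty L₀
    have h0 : h (F.toHLS (F.leafOf p₀)) = 0 := by
      rw [show F.leafOf p₀ = L₀ from hp₀]
      exact dist_self _
    obtain ⟨q, hq⟩ := intermediate_value_univ p₀ p hcont (h0.symm ▸ hr)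
    exact ⟨F.toHLS (F.leafOf q), Subtype.ext hq⟩
  · exact Isometry.of_dist_eq hiso
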